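/- Let $\Gamma$ be a finite Abelian group (written additively) and let $\Sigma\subseteq\Gamma$ be a generating set, $0\notin\Sigma$. We say that $\mathrm{Cay}(\Gamma,\Sigma)$ is a mixed Abelian Cayley graph with parameters $r_1,r_2,z$ if $\Sigma$ consists of exactly $r_1$ involutions, $r_2$ pairs $\{a,-a\}$ with $a\neq -a$, and $z$ elements $b$ with $-b\notin\Sigma$. Its vertex set is $\Gamma$, and every vertex $u$ is joined to $u+a$, $a\in\Sigma$, by an undirected edge if $-a\in\Sigma$ and by an arc from $u$ to $u+a$ otherwise. Its order is $|\Gamma|$, and its diameter is the maximum over ordered pairs $(u,v)$ of vertices of the length of a shortest walk from $u$ to $v$ that traverses arcs only in their direction. **Theorem.** For every $k\ge 2$, let $N(k)$ be the maximum order of a mixed Abelian Cayley graph with $r_1=1$, $r_2=0$, $z=2$ and diameter $k$. Then $N(2)=8$, $N(3)=12$, $N(4)=18$, and for every integer $x\ge 2$ $$N(3x-1)=6x^2,\qquad N(3x)=6x^2+4x,\qquad N(3x+1)=6x^2+8x+2 .$$ Moreover, the following mixed Abelian Cayley graphs $\mathrm{Cay}(\Gamma,\Sigma)$ have $r_1=1$,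 $r_2=0$, $z=2$, diameter $k$ and order $N=N(k)$ (in the last three items $x\ge2$, and integers stand for their residue classes): - $k=2$: $\Gamma=\mathbb Z_8$, $\Sigma=\{1,3,4\}$; $k=3$: $\Gamma=\mathbb Z_{12}$, $\Sigma=\{1,4,6\}$; $k=4$: $\Gamma=\mathbb Z_{18}$, $\Sigma=\{1,4,9\}$. - $k=3x-1$, $N=6x^2$: $\Gamma=\mathbb Z_2\times\mathbb Z_x\times\mathbb Z_{3x}$, $\Sigma=\{(1,0,0),(1,1,1),(1,3,2)\}$ if $x$ is even; $\Gamma=\mathbb Z_x\times\mathbb Z_{6x}$, $\Sigma=\{(0,3x),(1,-2),(3-x,3x-7)\}$ if $x$ is odd; $\Gamma=\mathbb Z_x\times\mathbb Z_{6x}$, $\Sigma=\{(0,3x),(3,2),(1,1)\}$ for every $x$. - $k=3x$, $N=6x^2+4x$: $\Gamma=\mathbb Z_2\times\mathbb Z_{N/2}$, $\Sigma=\{(1,0),(1,1),(-3x,-3x)\}$ if $x$ is even; $\Gamma=\mathbb Z_N$, $\Sigma=\{N/2,\,N/2+1,\,3x^2-x\}$ if $x$ is odd; $\Gamma=\mathbb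 Z_N$, $\Sigma=\{N/2,\,2x+1,\,x\}$ for every $x$. - $k=3x+1$, $N=6x^2+8x+2$: if $x$ is even, $\Gamma=\mathbb Z_N$ with $\Sigma=\{N/2,\,N/2+1,\,6x^2+5x\}$ and with $\Sigma=\{N/2,\,N/2-3x-2,\,N/2+1\}$; if $x$ is odd, $\Gamma=\mathbb Z_2\times\mathbb Z_{N/2}$ with $\Sigma=\{(1,0),(1,1),(-3x-2,-3x-2)\}$, and $\Gamma=\mathbb Z_N$ with $\Sigma=\{N/2,\,N/2-3x-2,\,1\}$. -/

import Mathlib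

/-- A mixed graph on the vertex set `V`: undirected edges together with directed arcs. -/
structure MixedGraph (V : Type*) where
  /-- the undirected edges -/
  edges : SimpleGraph V
  /-- the directed arcs -/
  arcs : Digraph V

namespace MixedGraph

variable {V : Type*}

/-- One can move from `u` to `v` in one step: along an edge, or along an arc in its direction. -/
def Step (G : MixedGraph V) (u v : V) : Prop :=
  G.edges.Adj u v ∨ G.arcs.Adj u v

/-- `G.HasWalk n u v`: there is a walk of length `n` from `u` to `v` that traverses arcs only in
their direction. -/
inductive HasWalk (G : MixedGraph V) : ℕ → V → V → Prop
  | nil (u : V) : HasWalk G 0 u u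
  | cons {n : ℕ} {u v w : V} (h : G.Step u v) (p : HasWalk G n v w) : HasWalk G (n + 1) u w

/-- The distance from `u` to `v`: the least length of a walk from `u` to `v`
(`⊤` if there is none). -/
noncomputable def dist (G : MixedGraph V) (u v : V) : ℕ∞ :=
  ⨅ (n : ℕ) (_ : G.HasWalk n u v), (n : ℕ∞)

/-- The diameter: the supremum of all distances between ordered pairs of vertices. -/
noncomputable def diam (G : MixedGraph V) : ℕ∞ :=
  ⨆ (u : V) (v : V), G.dist u v

end MixedGraph

/-- The Cayley mixed graph of the Abelian group `Γ` with connection set `S`. The vertex `u` is joined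
to `u + a` for every `a ∈ S`: by an edge if also `-a ∈ S`, and by an arc otherwise. -/
def cayleyMixedGraph {Γ : Type*} [AddCommGroup Γ] (S : Set Γ) : MixedGraph Γ where
  edges :=
    { Adj := fun u v => u ≠ v ∧ v - u ∈ S ∧ u - v ∈ S
      symm := ⟨fun _ _ h => ⟨h.1.symm, h.2.2, h.2.1⟩⟩
      loopless := ⟨fun _ h => h.1 rfl⟩ }
  arcs := { Adj := fun u v => v - u ∈ S ∧ u - v ∉ S }

/-- `S` is a generating set of the Abelian group `Γ` that consists of exactly `r₁` involutions,
`r₂` pairs `{a, -a}` with `a ≠ -a`, and `z` elements whose inverses are not in `S`. -/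
structure IsMixedGeneratingSet {Γ : Type*} [AddCommGroup Γ] (S : Set Γ) (r₁ r₂ z : ℕ) : Prop where
  zero_notMem : (0 : Γ) ∉ S
  closure_eq_top : AddSubgroup.closure S = ⊤
  involutions : {a ∈ S | -a = a}.encard = r₁
  pairs : {a ∈ S | -a ≠ a ∧ -a ∈ S}.encard = 2 * r₂
  arcs : {a ∈ S | -a ∉ S}.encard = z

/-- `Cay(Γ, S)` is a mixed Abelian Cayley graph with parameters `r₁`, `r₂`, `z`, of diameter `k` and
of (finite) order `N`. -/
structure IsMixedAbelianCayley {Γ : Type*} [AddCommGroup Γ] (S : Set Γ) (r₁ r₂ z k N : ℕ) :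
    Prop where
  finite : Finite Γ
  generating : IsMixedGeneratingSet S r₁ r₂ z
  diam_eq : (cayleyMixedGraph S).diam = k
  card_eq : Nat.card Γ = N

/-- `N` is the maximum order of a mixed Abelian Cayley graph with parameters `r₁`, `r₂`, `z` and
diameter `k`. (Every finite group has an isomorphic copy in `Type`.) -/
def IsMaxMixedAbelianCayleyOrder (r₁ r₂ z k N : ℕ) : Prop :=
  IsGreatest {n : ℕ | ∃ (Γ : Type) (_ : AddCommGroup Γ) (S : Set Γ),
    IsMixedAbelianCayley S r₁ r₂ z k n} N

/-! ### Diameter as a bound on walk lengths -/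

namespace MixedGraph

variable {V : Type*}

/-! Walks add up generators, so diameter at most `k` means that every element is a sum of at most
`k` terms from `c`, `a`, `b`, with `c` the involution (`Covers`). Modulo `{0, c}`, the group has
order `n = |Γ| / 2` and is generated by `a`, `b`; its least representations form an L-shape of area
`n` (`exists_lShape`).

Upper bound (`Covers.card_bound`): if `k - 1` terms always suffice in the quotient, optimizing the
L-shape gives `3n ≤ (k + 1)²`. Otherwise some coset needs `k` terms, which leaves none for `c`. Its
two elements then give two different representations of weight `k`; this degenerates the L-shape and
gives `4n ≤ (k + 2)²`. The second bound decides only for `k = 2, 3, 4`, hence the exceptional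
orders.

Lower bound (`isMixedAbelianCayley_of_relations`): two relations between `a` and `b`, valid up to
multiples of `c`, reduce all sums to an optimal L-shape of diameter `k - 1`, and one further step
along `c` fixes the lift. The upper bound for `k - 1` shows that the diameter is no smaller. -/

theorem diam_le_iff (G : MixedGraph V) (k : ℕ) :
    G.diam ≤ k ↔ ∀ u v, ∃ n ≤ k, G.HasWalk n u v := by
  have key : ∀ u v, G.dist u v ≤ k ↔ ∃ n ≤ k, G.HasWalk n u v := by
    intro u v
    constructor
    · intro h
      by_contra! hcon
      have h1 : ((k + 1 : ℕ) : ℕ∞) ≤ G.dist u v := by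
        refine le_iInf fun n => le_iInf fun hn => ?_
        by_contra hlt
        have : n ≤ k := by
          have := lt_of_not_ge hlt
          rw [Nat.cast_lt] at this
          omega
        exact hcon n this hn
      have h2 := h1.trans h
      rw [Nat.cast_le] at h2
      omega
    · rintro ⟨n, hn, hw⟩
      exact (iInf₂_le n hw).trans (by exact_mod_cast hn)
  simp only [diam, iSup_le_iff, key]

end MixedGraph

/-! ### Walks in a Cayley graph as sums of generators -/

section Covering

variable {Γ : Type*} [AddCommGroup Γ]

theorem cayleyMixedGraph_step_iff {S : Set Γ} (h0 : (0 : Γ) ∉ S) (u v : Γ) :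
    (cayleyMixedGraph S).Step u v ↔ v - u ∈ S := by
  unfold MixedGraph.Step cayleyMixedGraph
  simp only
  constructor
  · rintro (h | h)
    · exact h.2.1
    · exact h.1
  · intro h
    by_cases h' : u - v ∈ S
    · refine Or.inl ⟨?_, h, h'⟩
      rintro rfl
      exact h0 (by simpa using h)
    · exact Or.inr ⟨h, h'⟩

/-- Every element is a sum of at most `k` terms, each of them one of `c`, `a`, `b`. -/
def Covers (c a b : Γ) (k : ℕ) : Prop :=
  ∀ g : Γ, ∃ e i j : ℕ, e + i + j ≤ k ∧ g = e • c + i • a + j • b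

theorem exists_eq_add_of_hasWalk {S : Set Γ} (h0 : (0 : Γ) ∉ S) {c a b : Γ}
    (hS : S ⊆ {c, a, b}) {n : ℕ} {u v : Γ} (hw : (cayleyMixedGraph S).HasWalk n u v) :
    ∃ e i j : ℕ, e + i + j = n ∧ v = u + (e • c + i • a + j • b) := by
  induction hw with
  | nil u => exact ⟨0, 0, 0, rfl, by simp⟩
  | @cons n u v w h p ih =>
    obtain ⟨e, i, j, hn, hv⟩ := ih
    rw [cayleyMixedGraph_step_iff h0] at h
    have hvu : v = u + (v - u) := by abel
    rcases hS h with h | h | h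
    · refine ⟨e + 1, i, j, by omega, ?_⟩
      rw [hv, hvu, h, succ_nsmul]; abel
    · refine ⟨e, i + 1, j, by omega, ?_⟩
      rw [hv, hvu, h, succ_nsmul]; abel
    · refine ⟨e, i, j + 1, by omega, ?_⟩
      rw [hv, hvu, Set.mem_singleton_iff.1 h, succ_nsmul]; abel

theorem MixedGraph.HasWalk.trans {V : Type*} {G : MixedGraph V} {m n : ℕ} {u v w : V}
    (h : G.HasWalk m u v) (h' : G.HasWalk n v w) : G.HasWalk (m + n) u w := by
  induction h with
  | nil u => simpa using h'
  | @cons m u v x hs p ih =>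
    rw [Nat.add_right_comm]
    exact .cons hs (ih h')

theorem hasWalk_add_nsmul {S : Set Γ} (h0 : (0 : Γ) ∉ S) {s : Γ} (hs : s ∈ S) (n : ℕ) (u : Γ) :
    (cayleyMixedGraph S).HasWalk n u (u + n • s) := by
  induction n generalizing u with
  | zero => simpa using MixedGraph.HasWalk.nil u
  | succ n ih =>
    have h1 := ih (u + s)
    rw [show u + (n + 1) • s = u + s + n • s by rw [succ_nsmul]; abel]
    exact .cons ((cayleyMixedGraph_step_iff h0 _ _).2 (by simpa using hs)) h1

theorem covers_of_diam_le {S : Set Γ} (h0 : (0 : Γ) ∉ S) {c a b : Γ} (hS : S ⊆ {c, a, b}) {k : ℕ}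
    (h : (cayleyMixedGraph S).diam ≤ k) : Covers c a b k := by
  intro g
  obtain ⟨n, hn, hw⟩ := (MixedGraph.diam_le_iff _ _).1 h 0 g
  obtain ⟨e, i, j, rfl, hg⟩ := exists_eq_add_of_hasWalk h0 hS hw
  exact ⟨e, i, j, hn, by simpa using hg⟩

theorem diam_le_of_covers {c a b : Γ} (h0 : (0 : Γ) ∉ ({c, a, b} : Set Γ)) {k : ℕ}
    (h : Covers c a b k) : (cayleyMixedGraph ({c, a, b} : Set Γ)).diam ≤ k := by
  rw [MixedGraph.diam_le_iff]
  intro u v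
  obtain ⟨e, i, j, hk, hg⟩ := h (v - u)
  refine ⟨e + i + j, hk, ?_⟩
  have hv : v = u + e • c + i • a + j • b := by
    rw [add_assoc, add_assoc, ← add_assoc (e • c), ← hg]; abel
  rw [hv]
  exact ((hasWalk_add_nsmul h0 (by simp) e u).trans (hasWalk_add_nsmul h0 (by simp) i _)).trans
    (hasWalk_add_nsmul h0 (by simp) j _)

theorem Covers.closure_eq_top {c a b : Γ} {k : ℕ} (h : Covers c a b k) :
    AddSubgroup.closure ({c, a, b} : Set Γ) = ⊤ := by
  rw [eq_top_iff]
  rintro g -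
  obtain ⟨e, i, j, -, rfl⟩ := h g
  have hmem : ∀ s ∈ ({c, a, b} : Set Γ), s ∈ AddSubgroup.closure ({c, a, b} : Set Γ) :=
    fun s hs => AddSubgroup.subset_closure hs
  exact add_mem (add_mem (nsmul_mem (hmem c (by simp)) _) (nsmul_mem (hmem a (by simp)) _))
    (nsmul_mem (hmem b (by simp)) _)

end Covering

/-! ### L-shaped minimum distance diagrams for two generators -/

section DoubleLoop

variable {G : Type*} [AddCommGroup G]

/-- `(i, j)` represents `i • a + j • b` with the least possible weight `i + j` and, among the
representations of this weight, with the least first coordinate. -/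
def IsLeastRep (a b : G) (i j : ℕ) : Prop :=
  ∀ i' j' : ℕ, i' • a + j' • b = i • a + j • b → i + j < i' + j' ∨ i + j = i' + j' ∧ i ≤ i'

/-- The order by weight, then first coordinate, is translation invariant, so least representations
are closed under passing to smaller points. -/
theorem IsLeastRep.of_add {a b : G} {i j p q : ℕ} (h : IsLeastRep a b (i + p) (j + q)) :
    IsLeastRep a b i j := by
  intro i' j' he
  have := h (i' + p) (j' + q) (by
    rw [add_nsmul, add_nsmul, add_nsmul, add_nsmul, add_add_add_comm, he]; abel)
  omega

theorem IsLeastRep.mono {a b : G} {i j p q : ℕ} (h : IsLeastRep a b p q) (hi : i ≤ p)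
    (hj : j ≤ q) : IsLeastRep a b i j := by
  obtain ⟨s, rfl⟩ := Nat.exists_eq_add_of_le hi
  obtain ⟨t, rfl⟩ := Nat.exists_eq_add_of_le hj
  exact h.of_add

theorem IsLeastRep.eq {a b : G} {i j p q : ℕ} (h : IsLeastRep a b i j) (h' : IsLeastRep a b p q)
    (he : i • a + j • b = p • a + q • b) : i = p ∧ j = q := by
  have h1 := h p q he.symm
  have h2 := h' i j he
  omega

theorem exists_isLeastRep (a b : G) (p q : ℕ) :
    ∃ i j, IsLeastRep a b i j ∧ i • a + j • b = p • a + q • b ∧ i + j ≤ p + q := by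
  classical
  have hex : ∃ s i j, i + j = s ∧ i • a + j • b = p • a + q • b := ⟨_, p, q, rfl, rfl⟩
  have hex2 : ∃ i j, i + j = Nat.find hex ∧ i • a + j • b = p • a + q • b := Nat.find_spec hex
  obtain ⟨j, hs, he⟩ := Nat.find_spec hex2
  refine ⟨Nat.find hex2, j, ?_, he, ?_⟩
  · intro i' j' he'
    rw [he] at he'
    have h1 : Nat.find hex ≤ i' + j' := Nat.find_min' hex ⟨i', j', rfl, he'⟩
    rcases h1.lt_or_eq with h1 | h1
    · left; omega
    · right
      exact ⟨by omega, Nat.find_min' hex2 ⟨j', h1.symm, he'⟩⟩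
  · rw [hs]
    exact Nat.find_min' hex ⟨p, q, rfl, rfl⟩

/-- The L-shaped set of lattice points with sides `l`, `h`, and a `w × y` corner removed. -/
def lShape (l h w y : ℕ) : Finset (ℕ × ℕ) :=
  Finset.range l ×ˢ Finset.range (h - y) ∪ Finset.range (l - w) ×ˢ Finset.Ico (h - y) h

theorem mem_lShape {l h w y i j : ℕ} :
    (i, j) ∈ lShape l h w y ↔ i < l ∧ j < h ∧ (i < l - w ∨ j < h - y) := by
  simp only [lShape, Finset.mem_union, Finset.mem_product, Finset.mem_range, Finset.mem_Ico]
  omega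

theorem card_lShape {l h w y : ℕ} (hw : w ≤ l) (hy : y ≤ h) :
    (lShape l h w y).card + w * y = l * h := by
  rw [lShape, Finset.card_union_of_disjoint]
  · simp only [Finset.card_product, Finset.card_range, Nat.card_Ico]
    obtain ⟨p, rfl⟩ := Nat.exists_eq_add_of_le hw
    obtain ⟨q, rfl⟩ := Nat.exists_eq_add_of_le hy
    simp only [Nat.add_sub_cancel_left, Nat.add_sub_cancel]
    ring
  · rw [Finset.disjoint_left]
    rintro ⟨i, j⟩ h1 h2
    simp only [Finset.mem_product, Finset.mem_range, Finset.mem_Ico] at h1 h2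
    omega

/-- The least representations in a finite Abelian group form an L-shape. -/
theorem exists_lShape [Finite G] (a b : G) (hgen : ∀ g : G, ∃ i j : ℕ, g = i • a + j • b) :
    ∃ l h w y : ℕ, w < l ∧ y < h ∧ y ≤ l ∧ w < h ∧ l • a = y • b ∧
      (∀ i < l, IsLeastRep a b i 0) ∧
      Nat.card G + w * y = l * h ∧ ∀ i j, (i, j) ∈ lShape l h w y → IsLeastRep a b i j := by
  classical
  have hzero : IsLeastRep a b 0 0 := fun i' j' _ => by omega
  have hexl : ∃ l, ¬ IsLeastRep a b l 0 := by
    refine ⟨addOrderOf a, fun h => ?_⟩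
    have := (h.eq hzero (by simp [addOrderOf_nsmul_eq_zero])).1
    exact (addOrderOf_pos a).ne' this
  have hexh : ∃ h, ¬ IsLeastRep a b 0 h := by
    refine ⟨addOrderOf b, fun h => ?_⟩
    have := (h.eq hzero (by simp [addOrderOf_nsmul_eq_zero])).2
    exact (addOrderOf_pos b).ne' this
  obtain ⟨l, hl, hlmin⟩ : ∃ l, ¬ IsLeastRep a b l 0 ∧ ∀ i < l, IsLeastRep a b i 0 :=
    ⟨Nat.find hexl, Nat.find_spec hexl, fun i hi => not_not.1 (Nat.find_min hexl hi)⟩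
  obtain ⟨h, hh, hhmin⟩ : ∃ h, ¬ IsLeastRep a b 0 h ∧ ∀ j < h, IsLeastRep a b 0 j :=
    ⟨Nat.find hexh, Nat.find_spec hexh, fun i hi => not_not.1 (Nat.find_min hexh hi)⟩
  have hl_of : ∀ {i j}, IsLeastRep a b i j → i < l := fun {i j} hi => by
    by_contra hcon
    exact hl (hi.mono (by omega) (Nat.zero_le _))
  have hh_of : ∀ {i j}, IsLeastRep a b i j → j < h := fun {i j} hi => by
    by_contra hcon
    exact hh (hi.mono (Nat.zero_le _) (by omega))
  -- the two relations
  obtain ⟨y, hly, hyl, hymin⟩ : ∃ y, l • a = y • b ∧ y ≤ l ∧ IsLeastRep a b 0 y := by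
    obtain ⟨i, j, hij, he, hle⟩ := exists_isLeastRep a b l 0
    rcases Nat.eq_zero_or_pos i with rfl | hi
    · exact ⟨j, by simpa using he.symm, by omega, hij⟩
    · exfalso
      have hil : i ≤ l := by omega
      have h1 := hlmin (l - i) (by have := hl_of hzero; omega)
      have h2 : IsLeastRep a b 0 j := hij.mono (Nat.zero_le _) le_rfl
      have h3 : (l - i) • a + 0 • b = 0 • a + j • b := by
        have : (l - i) • a + i • a = l • a := by rw [← add_nsmul, Nat.sub_add_cancel hil]
        simp only [zero_nsmul, add_zero, zero_add] at he ⊢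
        rw [← this, add_comm] at he
        exact (add_right_cancel he).symm
      obtain ⟨h4, h5⟩ := h1.eq h2 h3
      have h6 : i = l := by omega
      subst h6; subst h5
      exact hl hij
  -- Ties favour `b`, so `w < h` is strict here, whereas `y = l` remains possible above.
  obtain ⟨w, hhw, hwh, hwmin⟩ : ∃ w, h • b = w • a ∧ w < h ∧ IsLeastRep a b w 0 := by
    obtain ⟨i, j, hij, he, hle⟩ := exists_isLeastRep a b 0 h
    rcases Nat.eq_zero_or_pos j with rfl | hj
    · refine ⟨i, by simpa using he.symm, ?_, hij⟩
      have := hij 0 h he.symm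
      have := hh_of hzero
      omega
    · exfalso
      have hjh : j ≤ h := by omega
      have h1 := hhmin (h - j) (by have := hh_of hzero; omega)
      have h2 : IsLeastRep a b i 0 := hij.mono le_rfl (Nat.zero_le _)
      have h3 : 0 • a + (h - j) • b = i • a + 0 • b := by
        have : (h - j) • b + j • b = h • b := by rw [← add_nsmul, Nat.sub_add_cancel hjh]
        simp only [zero_nsmul, add_zero, zero_add] at he ⊢
        rw [← this] at he
        exact (add_right_cancel he).symm
      obtain ⟨h4, h5⟩ := h1.eq h2 h3
      have h6 : j = h := by omega
      subst h6; subst h4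
      exact hh hij
  have hwl := hl_of hwmin
  have hyh := hh_of hymin
  -- no nonzero point of the L-shape represents zero
  have hnz : ∀ i j, (i, j) ∈ lShape l h w y → i • a + j • b = 0 → i = 0 ∧ j = 0 := by
    intro i j hm he
    rw [mem_lShape] at hm
    obtain ⟨hil, hjh, hor⟩ := hm
    rcases Nat.eq_zero_or_pos i with rfl | hi
    · exact (hhmin j hjh).eq hzero (by simpa using he)
    rcases hor with hor | hor
    -- Adding `w • a = h • b` to the zero relation moves it to an equality between the two axes,
    -- where points inside the sides are least and hence coincide.
    · exfalso
      have h3 : (w + i) • a + 0 • b = 0 • a + (h - j) • b := by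
        have : (h - j) • b + j • b = h • b := by rw [← add_nsmul, Nat.sub_add_cancel hjh.le]
        have h7 : (w + i) • a + j • b = (h - j) • b + j • b := by
          rw [this, hhw, add_nsmul, add_assoc, he, add_zero]
        simpa using add_right_cancel h7
      rcases Nat.eq_zero_or_pos j with rfl | hj
      · have := (hlmin i hil).eq hzero (by simpa using he)
        omega
      have := (hlmin (w + i) (by omega)).eq (hhmin (h - j) (by omega)) h3
      omega
    · exfalso
      have h3 : (l - i) • a + 0 • b = 0 • a + (y + j) • b := by
        have : (l - i) • a + i • a = l • a := by rw [← add_nsmul, Nat.sub_add_cancel hil.le]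
        have h7 : (l - i) • a + i • a = (y + j) • b + i • a := by
          rw [this, hly, add_nsmul, add_assoc, add_comm (j • b), he, add_zero]
        simpa using add_right_cancel h7
      have := (hlmin (l - i) (by omega)).eq (hhmin (y + j) (by omega)) h3
      omega
  -- The sum of the two relations says that the inner corner `(l - w, h - y)` represents zero, so
  -- nothing above it can be least.
  have hsub : ∀ {i j}, IsLeastRep a b i j → (i, j) ∈ lShape l h w y := by
    intro i j hij
    rw [mem_lShape]
    refine ⟨hl_of hij, hh_of hij, ?_⟩
    by_contra! hcon
    have h1 : IsLeastRep a b (l - w) (h - y) := hij.mono hcon.1 hcon.2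
    have h2 : (l - w) • a + (h - y) • b = 0 • a + 0 • b := by
      have e1 : (l - w) • a + w • a = l • a := by rw [← add_nsmul, Nat.sub_add_cancel hwl.le]
      have e2 : (h - y) • b + y • b = h • b := by rw [← add_nsmul, Nat.sub_add_cancel hyh.le]
      have e3 : (l - w) • a + (h - y) • b + (w • a + y • b) = 0 + (w • a + y • b) := by
        rw [add_add_add_comm, e1, e2, hly, hhw]; abel
      simpa using add_right_cancel e3
    have := h1.eq hzero h2
    omega
  -- For comparable points the difference lies in the L-shape and represents zero; for incomparable
  -- ones, cancellation equates a point of one axis with a point of the other.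
  have hinj_aux : ∀ i j i' j', (i, j) ∈ lShape l h w y → (i', j') ∈ lShape l h w y →
      i • a + j • b = i' • a + j' • b → i' ≤ i → i = i' ∧ j = j' := by
    intro i j i' j' hm hm' he hle
    obtain ⟨s, rfl⟩ := Nat.exists_eq_add_of_le hle
    rw [mem_lShape] at hm hm'
    rcases le_total j' j with hj | hj
    · obtain ⟨t, rfl⟩ := Nat.exists_eq_add_of_le hj
      have h1 : s • a + t • b = 0 := by
        have : i' • a + j' • b + (s • a + t • b) = i' • a + j' • b + 0 := by
          rw [add_zero]
          refine Eq.trans ?_ he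
          rw [add_nsmul, add_nsmul]; abel
        exact add_left_cancel this
      have := hnz s t (by rw [mem_lShape]; omega) h1
      omega
    · obtain ⟨t, rfl⟩ := Nat.exists_eq_add_of_le hj
      have h1 : s • a + 0 • b = 0 • a + t • b := by
        have : i' • a + j • b + (s • a) = i' • a + j • b + t • b := by
          rw [add_nsmul, add_nsmul] at he
          rw [add_right_comm, he, add_assoc]
        simpa using add_left_cancel this
      have := (hlmin s (by omega)).eq (hhmin t (by omega)) h1
      omega
  have hinj : ∀ i j i' j', (i, j) ∈ lShape l h w y → (i', j') ∈ lShape l h w y →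
      i • a + j • b = i' • a + j' • b → i = i' ∧ j = j' := by
    intro i j i' j' hm hm' he
    rcases le_total i' i with hle | hle
    · exact hinj_aux i j i' j' hm hm' he hle
    · have := hinj_aux i' j' i j hm' hm he.symm hle
      exact ⟨this.1.symm, this.2.symm⟩
  refine ⟨l, h, w, y, hwl, hyh, hyl, hwh, hly, hlmin, ?_, ?_⟩
  · rw [← card_lShape hwl.le hyh.le, ← Nat.card_eq_finsetCard]
    congr 1
    refine (Nat.card_congr (Equiv.ofBijective
      (fun p : lShape l h w y => p.1.1 • a + p.1.2 • b) ⟨?_, ?_⟩)).symm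
    · rintro ⟨⟨i, j⟩, hm⟩ ⟨⟨i', j'⟩, hm'⟩ he
      obtain ⟨rfl, rfl⟩ := hinj i j i' j' hm hm' he
      rfl
    · intro g
      obtain ⟨p, q, rfl⟩ := hgen g
      obtain ⟨i, j, hij, he, -⟩ := exists_isLeastRep a b p q
      exact ⟨⟨(i, j), hsub hij⟩, he⟩
  · intro i j hm
    obtain ⟨p, q, hpq, he, -⟩ := exists_isLeastRep a b i j
    obtain ⟨rfl, rfl⟩ := hinj _ _ _ _ hm (hsub hpq) he.symm
    exact hpq

end DoubleLoop

/-! ### Upper bounds on the order -/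

section UpperBound

/-- For `w ≤ y`, `n ≤ lh - w² ≤ (k + 2 + w)² / 4 - w²`, which falls short of `(k + 2)² / 3` by `(k +
2 - 3w)² / 12`. The optimum is thus near `w = y = (k + 2) / 3` and `l = h = 2w`. -/
theorem three_mul_le_of_lShape {l h w y n k : ℕ} (hn : n + w * y = l * h)
    (h1 : l + h ≤ k + 2 + y) (h2 : l + h ≤ k + 2 + w) : 3 * n ≤ (k + 2) ^ 2 := by
  wlog hwy : w ≤ y generalizing w y
  · exact this (by rw [mul_comm, hn]) h2 h1 (by omega)
  zify at *
  nlinarith [sq_nonneg ((l : ℤ) - h), sq_nonneg ((k : ℤ) + 2 - 3 * w),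
    mul_nonneg (sub_nonneg.2 hwy) (Int.natCast_nonneg w),
    mul_nonneg (sub_nonneg.2 h2) (by positivity : (0 : ℤ) ≤ l + h + k + 2 + w)]

variable {G : Type*} [AddCommGroup G]

/-- The order of a finite Abelian group all of whose elements are sums of at most `k` terms, each
of them one of `a`, `b`. -/
theorem three_mul_card_le [Finite G] {a b : G} {k : ℕ}
    (hcov : ∀ g : G, ∃ i j : ℕ, i + j ≤ k ∧ g = i • a + j • b) :
    3 * Nat.card G ≤ (k + 2) ^ 2 := by
  obtain ⟨l, h, w, y, hwl, hyh, hyl, hwh, -, -, hcard, hleast⟩ := exists_lShape a b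
    (fun g => by obtain ⟨i, j, -, hg⟩ := hcov g; exact ⟨i, j, hg⟩)
  have hk : ∀ i j, (i, j) ∈ lShape l h w y → i + j ≤ k := by
    intro i j hm
    obtain ⟨i', j', hle, he⟩ := hcov (i • a + j • b)
    have := hleast i j hm i' j' he.symm
    omega
  -- The two outer corners of the L-shape carry its maximal weight.
  have h1 := hk (l - 1) (h - y - 1) (by rw [mem_lShape]; omega)
  have h2 := hk (l - w - 1) (h - 1) (by rw [mem_lShape]; omega)
  exact three_mul_le_of_lShape hcard (by omega) (by omega)

/-- If some element needs `k` terms and can be written with `k` terms in two ways, then the removed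
corner of the L-shape is as wide as the L-shape itself, which gives a smaller bound. -/
theorem four_mul_card_le [Finite G] {a b : G} {k : ℕ}
    (hcov : ∀ g : G, ∃ i j : ℕ, i + j ≤ k ∧ g = i • a + j • b) {p q p' q' : ℕ}
    (hpq : p + q = k) (hpq' : p' + q' = k) (he : p • a + q • b = p' • a + q' • b) (hne : p < p')
    (hmin : ∀ i j : ℕ, i • a + j • b = p • a + q • b → k ≤ i + j) :
    4 * Nat.card G ≤ (k + 2) ^ 2 := by
  obtain ⟨l, h, w, y, hwl, hyh, hyl, hwh, hly, hlmin, hcard, hleast⟩ := exists_lShape a b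
    (fun g => by obtain ⟨i, j, -, hg⟩ := hcov g; exact ⟨i, j, hg⟩)
  have hk : ∀ i j, (i, j) ∈ lShape l h w y → i + j ≤ k := by
    intro i j hm
    obtain ⟨i', j', hle, he⟩ := hcov (i • a + j • b)
    have := hleast i j hm i' j' he.symm
    omega
  obtain ⟨t, rfl⟩ := Nat.exists_eq_add_of_le hne.le
  have hq : q = q' + t := by omega
  subst hq
  have ht : t • a = t • b := by
    have : p • a + q' • b + t • a = p • a + q' • b + t • b := by
      rw [add_nsmul, add_nsmul] at he
      rw [add_right_comm, ← he, add_assoc]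
    exact add_left_cancel this
  -- `(0, t)` ties with `(t, 0)` in weight and has the smaller first coordinate, so `(t, 0)` is not
  -- least.
  have hlt : l ≤ t := by
    by_contra! hcon
    have := hlmin t hcon 0 t (by simp [ht])
    omega
  obtain ⟨s, rfl⟩ := Nat.exists_eq_add_of_le hlt
  -- Trading `l • a` for `y • b` in the second representation gives weight `k - l + y`, which
  -- minimality bounds below by `k`.
  have hy : y = l := by
    have := hmin (p + s) (q' + y) (by
      rw [he, ← add_assoc, add_right_comm p l s, add_nsmul a (p + s) l, hly, add_nsmul b q' y]
      abel)
    omega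
  subst hy
  -- The area now factors as `y * (h - w)`, and this corner bounds the sum of the factors by `k +
  -- 2`; AM-GM finishes.
  have h2 := hk (y - w - 1) (h - 1) (by rw [mem_lShape]; omega)
  obtain ⟨v, rfl⟩ := Nat.exists_eq_add_of_le hwh.le
  have hc : Nat.card G = y * v := by
    have : Nat.card G + w * y = y * v + w * y := by rw [hcard]; ring
    omega
  have hv : y + v ≤ k + 2 := by omega
  rw [hc]
  have h3 : (y + v) ^ 2 ≤ (k + 2) ^ 2 := Nat.pow_le_pow_left hv 2
  have h4 : 4 * (y * v) ≤ (y + v) ^ 2 := by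
    zify; nlinarith [sq_nonneg ((y : ℤ) - v)]
  exact h4.trans h3

theorem nsmul_involution_eq {Γ : Type*} [AddCommGroup Γ] {c : Γ} (hc : c + c = 0) (e : ℕ) :
    e • c = (e % 2) • c := by
  conv_lhs => rw [← Nat.mod_add_div e 2, add_nsmul, mul_nsmul, two_nsmul, hc, nsmul_zero, add_zero]

variable {Γ : Type*} [AddCommGroup Γ]

open QuotientAddGroup in
theorem Covers.card_bound [Finite Γ] {c a b : Γ} {k : ℕ} (hc0 : c ≠ 0) (hc : c + c = 0)
    (hk : 1 ≤ k) (hcov : Covers c a b k) :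
    ∃ n, Nat.card Γ = 2 * n ∧ (3 * n ≤ (k + 1) ^ 2 ∨ 4 * n ≤ (k + 2) ^ 2) := by
  let C := AddSubgroup.zmultiples c
  have hCcard : Nat.card C = 2 := by
    rw [Nat.card_zmultiples]
    exact addOrderOf_eq_prime (by rw [two_nsmul, hc]) hc0
  refine ⟨Nat.card (Γ ⧸ C), ?_, ?_⟩
  · rw [C.card_eq_card_quotient_mul_card_addSubgroup, hCcard, mul_comm]
  have hcC : (mk c : Γ ⧸ C) = 0 := (eq_zero_iff c).2 (AddSubgroup.mem_zmultiples c)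
  have hproj : ∀ e i j : ℕ, (mk (e • c + i • a + j • b) : Γ ⧸ C) =
      i • (mk a : Γ ⧸ C) + j • (mk b : Γ ⧸ C) := by
    intro e i j
    rw [mk_add, mk_add, mk_nsmul, mk_nsmul, mk_nsmul, hcC, nsmul_zero, zero_add]
  have hcov' : ∀ g : Γ ⧸ C, ∃ i j : ℕ, i + j ≤ k ∧ g = i • (mk a : Γ ⧸ C) + j • (mk b : Γ ⧸ C) := by
    intro g
    obtain ⟨g, rfl⟩ := mk_surjective g
    obtain ⟨e, i, j, hle, rfl⟩ := hcov g
    exact ⟨i, j, by omega, hproj e i j⟩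
  by_cases hall : ∀ g : Γ ⧸ C, ∃ i j : ℕ,
      i + j ≤ k - 1 ∧ g = i • (mk a : Γ ⧸ C) + j • (mk b : Γ ⧸ C)
  · left
    have := three_mul_card_le hall
    rwa [show k - 1 + 2 = k + 1 by omega] at this
  · right
    push Not at hall
    obtain ⟨g, hg⟩ := hall
    obtain ⟨g, rfl⟩ := mk_surjective g
    -- The coset of `g` already uses up all `k` terms, so no lift of it can afford a `c`.
    have hlift : ∀ x : Γ, (mk x : Γ ⧸ C) = mk g → ∃ i j : ℕ, i + j = k ∧ x = i • a + j • b := by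
      intro x hx
      obtain ⟨e, i, j, hle, rfl⟩ := hcov x
      rw [hproj] at hx
      have : ¬ (i + j ≤ k - 1) := fun h => hg i j h hx.symm
      have he : e = 0 := by omega
      subst he
      exact ⟨i, j, by omega, by simp⟩
    obtain ⟨p, q, hpq, hg1⟩ := hlift g rfl
    obtain ⟨p', q', hpq', hg2⟩ := hlift (g + c) (by rw [mk_add, hcC, add_zero])
    have e1 : (mk g : Γ ⧸ C) = p • (mk a : Γ ⧸ C) + q • (mk b : Γ ⧸ C) := by
      have := hproj 0 p q
      rwa [zero_nsmul, zero_add, ← hg1] at this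
    have e2 : (mk g : Γ ⧸ C) = p' • (mk a : Γ ⧸ C) + q' • (mk b : Γ ⧸ C) := by
      have := hproj 0 p' q'
      rwa [zero_nsmul, zero_add, ← hg2, mk_add, hcC, add_zero] at this
    have hmin : ∀ i j : ℕ, i • (mk a : Γ ⧸ C) + j • (mk b : Γ ⧸ C) = mk g → k ≤ i + j := by
      intro i j hij
      by_contra! hlt
      exact hg i j (by omega) hij.symm
    rcases lt_trichotomy p p' with hlt | heq | hlt
    · exact four_mul_card_le hcov' hpq hpq' (e1.symm.trans e2) hlt (by rwa [← e1])
    · exfalso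
      have hq : q = q' := by omega
      subst heq; subst hq
      rw [← hg1] at hg2
      exact hc0 (by simpa using hg2)
    · exact four_mul_card_le hcov' hpq' hpq (e2.symm.trans e1) hlt (by rwa [← e2])

end UpperBound

/-! ### A criterion by two relations, and maximality -/

section Criterion

theorem card_le_of_forall_exists_eq {Γ ι : Type*} [Finite Γ] (s : Finset ι) (f : ι → Γ)
    (hf : ∀ g, ∃ i ∈ s, g = f i) : Nat.card Γ ≤ s.card := by
  classical
  have : Fintype Γ := Fintype.ofFinite Γ
  rw [Nat.card_eq_fintype_card, ← Finset.card_univ]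
  refine (Finset.card_le_card (t := s.image f) fun g _ => ?_).trans Finset.card_image_le
  obtain ⟨i, hi, hg⟩ := hf g
  exact Finset.mem_image.2 ⟨i, hi, hg.symm⟩

variable {Γ : Type*} [AddCommGroup Γ]

theorem exists_nsmul_eq_of_closure_eq_top [Finite Γ] {c a b : Γ}
    (hgen : AddSubgroup.closure ({c, a, b} : Set Γ) = ⊤) (g : Γ) :
    ∃ e i j : ℕ, g = e • c + i • a + j • b := by
  have hg : g ∈ AddSubgroup.closure ({c, a, b} : Set Γ) := hgen ▸ AddSubgroup.mem_top g
  induction hg using AddSubgroup.closure_induction with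
  | mem x hx =>
    rcases hx with rfl | rfl | hx
    · exact ⟨1, 0, 0, by simp⟩
    · exact ⟨0, 1, 0, by simp⟩
    · rw [Set.mem_singleton_iff] at hx
      exact ⟨0, 0, 1, by simp [hx]⟩
  | zero => exact ⟨0, 0, 0, by simp⟩
  | add x y _ _ hx hy =>
    obtain ⟨e, i, j, rfl⟩ := hx
    obtain ⟨e', i', j', rfl⟩ := hy
    exact ⟨e + e', i + i', j + j', by simp only [add_nsmul]; abel⟩
  | neg x _ hx =>
    obtain ⟨e, i, j, hx⟩ := hx
    refine ⟨(Nat.card Γ - 1) * e, (Nat.card Γ - 1) * i, (Nat.card Γ - 1) * j, ?_⟩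
    have h1 : (Nat.card Γ - 1) • x + x = 0 := by
      rw [← succ_nsmul, Nat.sub_add_cancel Nat.card_pos, card_nsmul_eq_zero']
    rw [mul_nsmul', mul_nsmul', mul_nsmul', ← nsmul_add, ← nsmul_add, ← hx]
    exact (eq_neg_of_add_eq_zero_left h1).symm

/-- Two relations between the generators reduce every representation to an L-shape. -/
theorem exists_mem_lShape_eq {c a b : Γ} {l h w y e₁ e₂ : ℕ} (hwl : w < l) (hyh : y < h)
    (hyl : y < l) (hwh : w < h) (hl : l • a = y • b + e₁ • c) (hh : h • b = w • a + e₂ • c)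
    (m : ℕ) : ∀ e i j : ℕ, i + j ≤ m → ∃ e' i' j' : ℕ, (i', j') ∈ lShape l h w y ∧
      e • c + i • a + j • b = e' • c + i' • a + j' • b := by
  induction m with
  | zero =>
    intro e i j hij
    exact ⟨e, i, j, by rw [mem_lShape]; omega, rfl⟩
  | succ m ih =>
    intro e i j hij
    by_cases hm : (i, j) ∈ lShape l h w y
    · exact ⟨e, i, j, hm, rfl⟩
    rw [mem_lShape] at hm
    by_cases hil : l ≤ i
    · obtain ⟨s, rfl⟩ := Nat.exists_eq_add_of_le hil
      obtain ⟨e', i', j', hm', he⟩ := ih (e + e₁) s (y + j) (by omega)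
      refine ⟨e', i', j', hm', he ▸ ?_⟩
      simp only [add_nsmul, hl]; abel
    by_cases hjh : h ≤ j
    · obtain ⟨s, rfl⟩ := Nat.exists_eq_add_of_le hjh
      obtain ⟨e', i', j', hm', he⟩ := ih (e + e₂) (w + i) s (by omega)
      refine ⟨e', i', j', hm', he ▸ ?_⟩
      simp only [add_nsmul, hh]; abel
    -- The point lies in the removed corner. Both relations together turn `(l - w, h - y)` into a
    -- multiple of `c`, so the weight drops here as well.
    obtain ⟨s, hs⟩ := Nat.exists_eq_add_of_le (show l - w ≤ i by omega)
    obtain ⟨t, ht⟩ := Nat.exists_eq_add_of_le (show h - y ≤ j by omega)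
    obtain ⟨e', i', j', hm', he⟩ := ih (e + (e₁ + e₂)) s t (by omega)
    refine ⟨e', i', j', hm', he ▸ ?_⟩
    obtain ⟨l', rfl⟩ := Nat.exists_eq_add_of_le hwl.le
    obtain ⟨h', rfl⟩ := Nat.exists_eq_add_of_le hyh.le
    rw [Nat.add_sub_cancel_left] at hs ht
    subst hs; subst ht
    have hcorner : l' • a + h' • b = (e₁ + e₂) • c := by
      have : w • a + y • b + (l' • a + h' • b) = w • a + y • b + (e₁ + e₂) • c := by
        calc _ = (w + l') • a + (y + h') • b := by simp only [add_nsmul]; abel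
          _ = _ := by rw [hl, hh, add_nsmul]; abel
      exact add_left_cancel this
    calc _ = e • c + (l' • a + h' • b) + s • a + t • b := by simp only [add_nsmul]; abel
      _ = _ := by rw [hcorner, add_nsmul c e]

theorem covers_of_relations [Finite Γ] {c a b : Γ}
    (hgen : AddSubgroup.closure ({c, a, b} : Set Γ) = ⊤) (hc : c + c = 0) {k l h w y e₁ e₂ : ℕ}
    (hwl : w < l) (hyh : y < h) (hyl : y < l) (hwh : w < h) (hl : l • a = y • b + e₁ • c)
    (hh : h • b = w • a + e₂ • c) (hk₁ : l + h ≤ k + 1 + y) (hk₂ : l + h ≤ k + 1 + w) :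
    Covers c a b k := by
  intro g
  obtain ⟨e, i, j, rfl⟩ := exists_nsmul_eq_of_closure_eq_top hgen g
  obtain ⟨e', i', j', hm, he⟩ := exists_mem_lShape_eq hwl hyh hyl hwh hl hh _ e i j le_rfl
  rw [mem_lShape] at hm
  -- The L-shape has weight at most `k - 1`, leaving one term for `c`.
  refine ⟨e' % 2, i', j', by omega, ?_⟩
  rw [he, nsmul_involution_eq hc e']

theorem Covers.swap {c a b : Γ} {k : ℕ} (h : Covers c a b k) : Covers c b a k := by
  intro g
  obtain ⟨e, i, j, hk, rfl⟩ := h g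
  exact ⟨e, j, i, by omega, by abel⟩

/-- Only the parity of the coefficient of `a` matters; `2 * j + i % 2` encodes it with `j` without
exceeding `2 * k`. This and the next two linear bounds exclude degenerate generators in large
groups. -/
theorem Covers.card_le_of_add_self [Finite Γ] {c a b : Γ} {k : ℕ} (h : Covers c a b k)
    (hc : c + c = 0) (ha : a + a = 0) : Nat.card Γ ≤ 2 * (2 * k + 1) := by
  have := card_le_of_forall_exists_eq (Finset.range 2 ×ˢ Finset.range (2 * k + 1))
    (fun p => p.1 • c + (p.2 % 2) • a + (p.2 / 2) • b) fun g => ?_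
  · simpa using this
  obtain ⟨e, i, j, hk, rfl⟩ := h g
  refine ⟨(e % 2, 2 * j + i % 2), ?_, ?_⟩
  · simp only [Finset.mem_product, Finset.mem_range]; omega
  · rw [nsmul_involution_eq hc e, nsmul_involution_eq ha i]
    simp only
    congr 3 <;> omega

theorem Covers.card_le_of_add_eq_zero [Finite Γ] {c a b : Γ} {k : ℕ} (h : Covers c a b k)
    (hc : c + c = 0) (hab : a + b = 0) : Nat.card Γ ≤ 2 * (2 * k + 1) := by
  have := card_le_of_forall_exists_eq (Finset.range 2 ×ˢ Finset.Icc (-k : ℤ) k)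
    (fun p => p.1 • c + p.2 • a) fun g => ?_
  · simp only [Finset.card_product, Finset.card_range, Int.card_Icc] at this
    omega
  obtain ⟨e, i, j, hk, rfl⟩ := h g
  refine ⟨(e % 2, (i : ℤ) - j), ?_, ?_⟩
  · simp only [Finset.mem_product, Finset.mem_range, Finset.mem_Icc]; omega
  · rw [nsmul_involution_eq hc e, eq_neg_of_add_eq_zero_right hab, neg_nsmul]
    simp only [sub_zsmul, natCast_zsmul]
    abel

theorem Covers.card_le_of_eq [Finite Γ] {c a b : Γ} {k : ℕ} (h : Covers c a b k)
    (hc : c + c = 0) (hab : a = b) : Nat.card Γ ≤ 2 * (k + 1) := by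
  have := card_le_of_forall_exists_eq (Finset.range 2 ×ˢ Finset.range (k + 1))
    (fun p => p.1 • c + p.2 • a) fun g => ?_
  · simpa using this
  obtain ⟨e, i, j, hk, rfl⟩ := h g
  refine ⟨(e % 2, i + j), ?_, ?_⟩
  · simp only [Finset.mem_product, Finset.mem_range]; omega
  · rw [nsmul_involution_eq hc e, ← hab, add_nsmul, add_assoc]

/-- The hypothesis `hN` negates both alternatives of `Covers.card_bound` at `k - 1`, which rules out
a smaller diameter. -/
theorem isMixedAbelianCayley_of_covers [Finite Γ] {c a b : Γ} {k N : ℕ} (hk : 2 ≤ k)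
    (hc0 : c ≠ 0) (hc : c + c = 0) (ha : a + a ≠ 0) (hb : b + b ≠ 0) (hab : a ≠ b)
    (hab' : a + b ≠ 0) (hcov : Covers c a b k) (hcard : Nat.card Γ = N)
    (hN : ∀ n, N = 2 * n → k ^ 2 < 3 * n ∧ (k + 1) ^ 2 < 4 * n) :
    IsMixedAbelianCayley ({c, a, b} : Set Γ) 1 0 2 k N := by
  have hnc : -c = c := neg_eq_of_add_eq_zero_left hc
  have hna : -a ≠ a := fun h => ha (by nth_rewrite 1 [← h]; simp)
  have hnb : -b ≠ b := fun h => hb (by nth_rewrite 1 [← h]; simp)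
  have hnab : -a ≠ b := fun h => hab' (by rw [← h]; simp)
  have hnba : -b ≠ a := fun h => hab' (by rw [← h]; simp)
  have hac : a ≠ c := fun h => ha (h ▸ hc)
  have hbc : b ≠ c := fun h => hb (h ▸ hc)
  have hnac : -a ≠ c := fun h => hac (by rw [← neg_neg a, h, hnc])
  have hnbc : -b ≠ c := fun h => hbc (by rw [← neg_neg b, h, hnc])
  have ha0 : a ≠ 0 := fun h => ha (by simp [h])
  have hb0 : b ≠ 0 := fun h => hb (by simp [h])
  have h0 : (0 : Γ) ∉ ({c, a, b} : Set Γ) := by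
    simp [hc0.symm, ha0.symm, hb0.symm]
  refine ⟨inferInstance, ⟨h0, hcov.closure_eq_top, ?_, ?_, ?_⟩, ?_, hcard⟩
  · have : {s ∈ ({c, a, b} : Set Γ) | -s = s} = {c} := by
      ext s
      simp only [Set.mem_ofPred_eq, Set.mem_insert_iff, Set.mem_singleton_iff]
      constructor
      · rintro ⟨rfl | rfl | rfl, h⟩
        · rfl
        · exact absurd h hna
        · exact absurd h hnb
      · rintro rfl
        exact ⟨Or.inl rfl, hnc⟩
    rw [this, Set.encard_singleton, Nat.cast_one]
  · have : {s ∈ ({c, a, b} : Set Γ) | -s ≠ s ∧ -s ∈ ({c, a, b} : Set Γ)} = ∅ := by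
      ext s
      simp only [Set.mem_ofPred_eq, Set.mem_insert_iff, Set.mem_singleton_iff,
        Set.mem_empty_iff_false, iff_false]
      rintro ⟨rfl | rfl | rfl, h, h'⟩ <;> simp_all
    rw [this]; simp
  · have : {s ∈ ({c, a, b} : Set Γ) | -s ∉ ({c, a, b} : Set Γ)} = {a, b} := by
      ext s
      simp only [Set.mem_ofPred_eq, Set.mem_insert_iff, Set.mem_singleton_iff]
      constructor
      · rintro ⟨rfl | rfl | rfl, h⟩ <;> simp_all
      · rintro (rfl | rfl) <;> simp_all
    rw [this, Set.encard_pair hab]; norm_num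
  · refine le_antisymm (diam_le_of_covers h0 hcov) ?_
    by_contra hcon
    obtain ⟨m, rfl⟩ := Nat.exists_eq_add_of_le' (show 1 ≤ k by omega)
    have hm : (cayleyMixedGraph ({c, a, b} : Set Γ)).diam ≤ m := by
      rw [not_le] at hcon
      exact Order.le_of_lt_add_one (by exact_mod_cast hcon)
    obtain ⟨n, hn, hbd⟩ :=
      (covers_of_diam_le h0 subset_rfl hm).card_bound hc0 hc (by omega)
    have := hN n (by rw [← hcard, hn])
    rcases hbd with h | h
    · omega
    · have h2 : m + 1 + 1 = m + 2 := rfl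
      rw [h2] at this
      omega

/-- A sufficient criterion in terms of two relations between the generators. -/
theorem isMixedAbelianCayley_of_relations [Finite Γ] {c a b : Γ} {k n N l h w y e₁ e₂ : ℕ}
    (hk : 5 ≤ k) (hN : N = 2 * n) (hn : (k + 1) ^ 2 ≤ 3 * n + 1) (hcard : Nat.card Γ = N)
    (hgen : AddSubgroup.closure ({c, a, b} : Set Γ) = ⊤) (hc : c + c = 0)
    (hwl : w < l) (hyh : y < h) (hyl : y < l) (hwh : w < h) (hl : l • a = y • b + e₁ • c)
    (hh : h • b = w • a + e₂ • c) (hk₁ : l + h ≤ k + 1 + y) (hk₂ : l + h ≤ k + 1 + w) :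
    IsMixedAbelianCayley ({c, a, b} : Set Γ) 1 0 2 k N := by
  have hcov := covers_of_relations hgen hc hwl hyh hyl hwh hl hh hk₁ hk₂
  -- Tight at `k = 5`, where `n ≥ 12`.
  have hbig : 2 * k + 1 < n := by nlinarith
  refine isMixedAbelianCayley_of_covers (by omega) ?_ hc ?_ ?_ ?_ ?_ hcov hcard ?_
  · rintro rfl
    have := three_mul_card_le (a := a) (b := b) (k := k) fun g => by
      obtain ⟨e, i, j, hle, hg⟩ := hcov g
      exact ⟨i, j, by omega, by simpa using hg⟩
    rw [hcard, hN] at this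
    nlinarith
  · intro h
    have := hcov.card_le_of_add_self hc h
    omega
  · intro h
    have := hcov.swap.card_le_of_add_self hc h
    omega
  · intro h
    have := hcov.card_le_of_eq hc h
    omega
  · intro h
    have := hcov.card_le_of_add_eq_zero hc h
    omega
  · intro m hm
    have : m = n := by omega
    subst this
    constructor <;> nlinarith

theorem IsMixedAbelianCayley.card_bound {S : Set Γ} {k N : ℕ} (hk : 1 ≤ k)
    (h : IsMixedAbelianCayley S 1 0 2 k N) :
    ∃ n, N = 2 * n ∧ (3 * n ≤ (k + 1) ^ 2 ∨ 4 * n ≤ (k + 2) ^ 2) := by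
  have := h.finite
  obtain ⟨c, hc⟩ := Set.encard_eq_one.1 (by simpa using h.generating.involutions)
  obtain ⟨a, b, -, hab⟩ := Set.encard_eq_two.1 (by simpa using h.generating.arcs)
  have hpairs := h.generating.pairs
  simp only [Nat.cast_zero, mul_zero, Set.encard_eq_zero] at hpairs
  have hcS : c ∈ {a ∈ S | -a = a} := by rw [hc]; rfl
  have hS : S ⊆ {c, a, b} := by
    intro s hs
    by_cases h1 : -s = s
    · have : s ∈ {a ∈ S | -a = a} := ⟨hs, h1⟩
      rw [hc] at this
      exact Or.inl this
    by_cases h2 : -s ∈ S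
    · have : s ∈ {a ∈ S | -a ≠ a ∧ -a ∈ S} := ⟨hs, h1, h2⟩
      rw [hpairs] at this
      exact this.elim
    · have : s ∈ {a ∈ S | -a ∉ S} := ⟨hs, h2⟩
      rw [hab] at this
      exact Or.inr this
  have h0 := h.generating.zero_notMem
  have hc0 : c ≠ 0 := fun h' => h0 (h' ▸ hcS.1)
  have hcc : c + c = 0 := by nth_rewrite 1 [← hcS.2]; simp
  rw [← h.card_eq]
  exact (covers_of_diam_le h0 hS h.diam_eq.le).card_bound hc0 hcc hk

theorem isMaxMixedAbelianCayleyOrder_of_witness {Γ : Type} [AddCommGroup Γ] {S : Set Γ}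
    {k n N : ℕ} (hk : 1 ≤ k) (hN : N = 2 * n) (h : IsMixedAbelianCayley S 1 0 2 k N)
    (hn : ∀ m, 3 * m ≤ (k + 1) ^ 2 ∨ 4 * m ≤ (k + 2) ^ 2 → m ≤ n) :
    IsMaxMixedAbelianCayleyOrder 1 0 2 k N := by
  refine ⟨⟨Γ, inferInstance, S, h⟩, ?_⟩
  rintro M ⟨Δ, _, T, hT⟩
  obtain ⟨m, rfl, hm⟩ := hT.card_bound hk
  have := hn m hm
  omega

/-- Squares are `0` or `1` modulo `3`, so `hn` says that `n` is at least the floor of `(k + 1)² /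
3`. Exceeding `n` under the other bound would force `k² ≤ 4k`, impossible from `k = 5` on. -/
theorem isMaxMixedAbelianCayleyOrder_of_le {Γ : Type} [AddCommGroup Γ] {S : Set Γ}
    {k n N : ℕ} (hk : 5 ≤ k) (hN : N = 2 * n) (hn : (k + 1) ^ 2 ≤ 3 * n + 1)
    (h : IsMixedAbelianCayley S 1 0 2 k N) : IsMaxMixedAbelianCayleyOrder 1 0 2 k N := by
  refine isMaxMixedAbelianCayleyOrder_of_witness (by omega) hN h ?_
  rintro m (hm | hm)
  · omega
  · by_contra! hlt
    nlinarith

end Criterion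

/-! ### The extremal graphs -/

section Families

theorem closure_eq_top_of_one_mem {N : ℕ} {S : Set (ZMod N)}
    (h : (1 : ZMod N) ∈ AddSubgroup.closure S) : AddSubgroup.closure S = ⊤ := by
  rw [eq_top_iff]
  rintro g -
  obtain ⟨m, rfl⟩ := ZMod.intCast_surjective g
  simpa using zsmul_mem h m

theorem AddSubgroup.eq_top_of_prod {A B : Type*} [AddCommGroup A] [AddCommGroup B]
    {H : AddSubgroup (A × B)} (h₁ : ∀ a, (a, 0) ∈ H) (h₂ : ∀ b, (0, b) ∈ H) : H = ⊤ := by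
  rw [eq_top_iff]
  rintro ⟨a, b⟩ -
  simpa using add_mem (h₁ a) (h₂ b)

theorem mk_zero_mem {A : ℕ} {B : Type*} [AddCommGroup B] {H : AddSubgroup (ZMod A × B)}
    (h : ((1 : ZMod A), (0 : B)) ∈ H) (a : ZMod A) : (a, (0 : B)) ∈ H := by
  obtain ⟨m, rfl⟩ := ZMod.intCast_surjective a
  simpa using zsmul_mem h m

theorem zero_mk_mem {A : ℕ} {B : Type*} [AddCommGroup B] {H : AddSubgroup (B × ZMod A)}
    (h : ((0 : B), (1 : ZMod A)) ∈ H) (a : ZMod A) : ((0 : B), a) ∈ H := by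
  obtain ⟨m, rfl⟩ := ZMod.intCast_surjective a
  simpa using zsmul_mem h m

theorem mem_closure_triple {Γ : Type*} [AddCommGroup Γ] {c a b g : Γ} (p q r : ℤ)
    (h : g = p • c + q • a + r • b) : g ∈ AddSubgroup.closure ({c, a, b} : Set Γ) := by
  have hmem : ∀ s ∈ ({c, a, b} : Set Γ), s ∈ AddSubgroup.closure ({c, a, b} : Set Γ) :=
    fun s hs => AddSubgroup.subset_closure hs
  rw [h]
  exact add_mem (add_mem (zsmul_mem (hmem c (by simp)) _) (zsmul_mem (hmem a (by simp)) _))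
    (zsmul_mem (hmem b (by simp)) _)

theorem ZMod.natCast_eq_zero_of_eq {N M : ℕ} (h : N = M) : (M : ZMod N) = 0 := by
  subst h
  exact ZMod.natCast_self N

theorem covers_zmod {N k : ℕ} {c a b : ZMod N} (h : ∀ g : ZMod N, ∃ e i j : Fin (k + 1),
    (e : ℕ) + i + j ≤ k ∧ g = (e : ℕ) * c + (i : ℕ) * a + (j : ℕ) * b) : Covers c a b k := by
  intro g
  obtain ⟨e, i, j, hk, hg⟩ := h g
  exact ⟨e, i, j, hk, by simpa using hg⟩

theorem isMixedAbelianCayley_eight :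
    IsMixedAbelianCayley ({1, 3, 4} : Set (ZMod 8)) 1 0 2 2 8 := by
  rw [show ({1, 3, 4} : Set (ZMod 8)) = {4, 1, 3} by ext; simp; tauto]
  exact isMixedAbelianCayley_of_covers le_rfl (by decide) (by decide) (by decide) (by decide)
    (by decide) (by decide) (covers_zmod (by decide)) (by simp) (by omega)

theorem isMixedAbelianCayley_twelve :
    IsMixedAbelianCayley ({1, 4, 6} : Set (ZMod 12)) 1 0 2 3 12 := by
  rw [show ({1, 4, 6} : Set (ZMod 12)) = {6, 1, 4} by ext; simp; tauto]
  exact isMixedAbelianCayley_of_covers (by omega) (by decide) (by decide) (by decide) (by decide)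
    (by decide) (by decide) (covers_zmod (by decide)) (by simp) (by omega)

theorem isMixedAbelianCayley_eighteen :
    IsMixedAbelianCayley ({1, 4, 9} : Set (ZMod 18)) 1 0 2 4 18 := by
  rw [show ({1, 4, 9} : Set (ZMod 18)) = {9, 1, 4} by ext; simp; tauto]
  exact isMixedAbelianCayley_of_covers (by omega) (by decide) (by decide) (by decide) (by decide)
    (by decide) (by decide) (covers_zmod (by decide)) (by simp) (by omega)

variable {x : ℕ}

/-! ### Diameter `3 * x - 1` -/

theorem sq_bound_sub_one (hx : 2 ≤ x) : (3 * x - 1 + 1) ^ 2 ≤ 3 * (3 * x ^ 2) + 1 := by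
  rw [Nat.sub_add_cancel (by omega)]
  nlinarith

/-- All families use the optimal shape `w = y = x` with sides `2x` or `2x + 1`; here the area is
`4x² - x²`. The relation `2x • a = x • b` holds only modulo `c`: the second coordinates `4x` and `x`
differ by `3x`, hence `e₁ = 1`. -/
theorem isMixedAbelianCayley_sub_one (hx : 2 ≤ x) :
    IsMixedAbelianCayley
      ({(0, ((3 * x : ℤ) : ZMod (6 * x))), (3, 2), (1, 1)} : Set (ZMod x × ZMod (6 * x)))
      1 0 2 (3 * x - 1) (6 * x ^ 2) := by
  have : NeZero x := ⟨by omega⟩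
  have : NeZero (6 * x) := ⟨by omega⟩
  have h6 : (6 * x : ZMod (6 * x)) = 0 := by exact_mod_cast ZMod.natCast_self (6 * x)
  refine isMixedAbelianCayley_of_relations (n := 3 * x ^ 2) (l := 2 * x) (h := 2 * x) (w := x)
    (y := x) (e₁ := 1) (e₂ := 0) (by omega) (by ring) (sq_bound_sub_one hx) ?_ ?_ ?_ (by omega)
    (by omega) (by omega) (by omega) ?_ ?_ (by omega) (by omega)
  · simp only [Nat.card_prod, Nat.card_zmod]; ring
  · refine AddSubgroup.eq_top_of_prod (mk_zero_mem (mem_closure_triple 0 1 (-2) ?_))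
      (zero_mk_mem (mem_closure_triple 0 (-1) 3 ?_)) <;> ext <;> simp <;> ring
  · ext
    · simp
    · simp; linear_combination h6
  · ext
    · simp
    · simp; ring
  · ext
    · simp
    · simp; ring

theorem isMixedAbelianCayley_sub_one_of_even (hx : 2 ≤ x) (he : Even x) :
    IsMixedAbelianCayley
      ({(1, 0, 0), (1, 1, 1), (1, 3, 2)} : Set (ZMod 2 × ZMod x × ZMod (3 * x)))
      1 0 2 (3 * x - 1) (6 * x ^ 2) := by
  have : NeZero x := ⟨by omega⟩
  have : NeZero (3 * x) := ⟨by omega⟩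
  have h3 : (3 * x : ZMod (3 * x)) = 0 := by exact_mod_cast ZMod.natCast_self (3 * x)
  have h2 : (x : ZMod 2) = 0 := (ZMod.natCast_eq_zero_iff_even).2 he
  refine isMixedAbelianCayley_of_relations (n := 3 * x ^ 2) (l := 2 * x) (h := 2 * x) (w := x)
    (y := x) (e₁ := 0) (e₂ := 0) (by omega) (by ring) (sq_bound_sub_one hx) ?_ ?_ ?_ (by omega)
    (by omega) (by omega) (by omega) ?_ ?_ (by omega) (by omega)
  · simp only [Nat.card_prod, Nat.card_zmod]; ring
  · set H := AddSubgroup.closure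
      ({(1, 0, 0), (1, 1, 1), (1, 3, 2)} : Set (ZMod 2 × ZMod x × ZMod (3 * x)))
    have e1 : ((1, 0, 0) : ZMod 2 × ZMod x × ZMod (3 * x)) ∈ H :=
      mem_closure_triple 1 0 0 (by simp)
    have e2 : ((0, 1, 0) : ZMod 2 × ZMod x × ZMod (3 * x)) ∈ H :=
      mem_closure_triple 1 (-2) 1 (by ext <;> simp <;> first | ring1 | decide)
    have e3 : ((0, 0, 1) : ZMod 2 × ZMod x × ZMod (3 * x)) ∈ H :=
      mem_closure_triple (-2) 3 (-1) (by ext <;> simp <;> first | ring1 | decide)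
    refine AddSubgroup.eq_top_of_prod (mk_zero_mem e1) ?_
    rintro ⟨u, v⟩
    obtain ⟨m, rfl⟩ := ZMod.intCast_surjective u
    obtain ⟨n, rfl⟩ := ZMod.intCast_surjective v
    simpa using add_mem (zsmul_mem e2 m) (zsmul_mem e3 n)
  · ext
    · simp; decide
    · simp
    · simp
  · ext
    · simp; linear_combination h2
    · simp
    · simp; ring
  · ext
    · simp; linear_combination h2
    · simp
    · simp; linear_combination h3

theorem isMixedAbelianCayley_sub_one_of_odd (hx : 2 ≤ x) (ho : Odd x) :
    IsMixedAbelianCayley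
      ({(0, ((3 * x : ℤ) : ZMod (6 * x))), (1, -2),
        (((3 - x : ℤ) : ZMod x), ((3 * x - 7 : ℤ) : ZMod (6 * x)))} : Set (ZMod x × ZMod (6 * x)))
      1 0 2 (3 * x - 1) (6 * x ^ 2) := by
  have : NeZero x := ⟨by omega⟩
  have : NeZero (6 * x) := ⟨by omega⟩
  have h6 : (6 * x : ZMod (6 * x)) = 0 := by exact_mod_cast ZMod.natCast_self (6 * x)
  -- Oddness enters through `x • c = c`: it gives `3x * x = 3x` modulo `6x`.
  obtain ⟨m, hm⟩ := ho
  have hm' : (x : ZMod (6 * x)) = 2 * m + 1 := by exact_mod_cast congrArg Nat.cast hm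
  refine isMixedAbelianCayley_of_relations (n := 3 * x ^ 2) (l := 2 * x) (h := 2 * x) (w := x)
    (y := x) (e₁ := 0) (e₂ := 0) (by omega) (by ring) (sq_bound_sub_one hx) ?_ ?_ ?_ (by omega)
    (by omega) (by omega) (by omega) ?_ ?_ (by omega) (by omega)
  · simp only [Nat.card_prod, Nat.card_zmod]; ring
  · refine AddSubgroup.eq_top_of_prod (mk_zero_mem (mem_closure_triple 2 7 (-2) ?_))
      (zero_mk_mem (mem_closure_triple 1 3 (-1) ?_)) <;> ext <;> simp <;> ring
  · ext
    · simp
    · simp; linear_combination h6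
  · ext
    · simp
    · simp; linear_combination -(m : ZMod (6 * x)) * h6 - (3 * x : ZMod (6 * x)) * hm'
  · ext
    · simp
    · simp; linear_combination (x - 2 : ZMod (6 * x)) * h6

/-! ### Diameter `3 * x` -/

/-- The area is `2x(2x + 1) - x² = n`. The same number is the discrepancy in the first relation, so
it equals `c` and `e₁ = 1`. -/
theorem isMixedAbelianCayley_three_mul (hx : 2 ≤ x) {n N : ℕ} (hn : n = 3 * x ^ 2 + 2 * x)
    (hN : N = 2 * n) :
    IsMixedAbelianCayley
      ({(n : ZMod N), ((2 * x + 1 : ℕ) : ZMod N), (x : ZMod N)} : Set (ZMod N))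
      1 0 2 (3 * x) N := by
  have : NeZero N := ⟨by rw [hN, hn]; positivity⟩
  have hn' : (n : ZMod N) = 3 * x ^ 2 + 2 * x := by exact_mod_cast congrArg Nat.cast hn
  have h0 : (2 * n : ZMod N) = 0 := by exact_mod_cast ZMod.natCast_eq_zero_of_eq hN
  refine isMixedAbelianCayley_of_relations (n := n) (l := 2 * x) (h := 2 * x + 1) (w := x)
    (y := x) (e₁ := 1) (e₂ := 0) (by omega) hN (by rw [hn]; nlinarith) (Nat.card_zmod N)
    (closure_eq_top_of_one_mem (mem_closure_triple 0 1 (-2) ?_)) ?_ (by omega)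
    (by omega) (by omega) (by omega) ?_ ?_ (by omega) (by omega)
  · simp
  · linear_combination h0
  · simp; linear_combination -hn'
  · simp; ring

theorem isMixedAbelianCayley_three_mul_of_odd (hx : 2 ≤ x) (ho : Odd x) {n N : ℕ}
    (hn : n = 3 * x ^ 2 + 2 * x) (hN : N = 2 * n) :
    IsMixedAbelianCayley
      ({(n : ZMod N), ((n + 1 : ℕ) : ZMod N), ((3 * x ^ 2 - x : ℤ) : ZMod N)} : Set (ZMod N))
      1 0 2 (3 * x) N := by
  have : NeZero N := ⟨by rw [hN, hn]; positivity⟩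
  have hn' : (n : ZMod N) = 3 * x ^ 2 + 2 * x := by exact_mod_cast congrArg Nat.cast hn
  have h0 : (2 * n : ZMod N) = 0 := by exact_mod_cast ZMod.natCast_eq_zero_of_eq hN
  obtain ⟨m, hm⟩ := ho
  have hm' : (x : ZMod N) = 2 * m + 1 := by exact_mod_cast congrArg Nat.cast hm
  refine isMixedAbelianCayley_of_relations (n := n) (l := 2 * x) (h := 2 * x + 1) (w := x)
    (y := x) (e₁ := 0) (e₂ := 0) (by omega) hN (by rw [hn]; nlinarith) (Nat.card_zmod N)
    (closure_eq_top_of_one_mem (mem_closure_triple (-1) 1 0 ?_)) ?_ (by omega)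
    (by omega) (by omega) (by omega) ?_ ?_ (by omega) (by omega)
  · simp
  · linear_combination h0
  · simp; linear_combination (m + 1 : ZMod N) * h0 + (n : ZMod N) * hm' + (x - 1 : ZMod N) * hn'
  · simp; linear_combination (m : ZMod N) * h0 + (n : ZMod N) * hm' - (2 * x - 1 : ZMod N) * hn'

theorem isMixedAbelianCayley_three_mul_of_even (hx : 2 ≤ x) (he : Even x) {n N : ℕ}
    (hn : n = 3 * x ^ 2 + 2 * x) (hN : N = 2 * n) :
    IsMixedAbelianCayley
      ({(1, 0), (1, 1), (((-(3 * x) : ℤ) : ZMod 2), ((-(3 * x) : ℤ) : ZMod n))} :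
        Set (ZMod 2 × ZMod n))
      1 0 2 (3 * x) N := by
  have : NeZero n := ⟨by rw [hn]; positivity⟩
  have h2 : (x : ZMod 2) = 0 := (ZMod.natCast_eq_zero_iff_even).2 he
  have h0 : (3 * x ^ 2 + 2 * x : ZMod n) = 0 := by exact_mod_cast ZMod.natCast_eq_zero_of_eq hn
  refine isMixedAbelianCayley_of_relations (n := n) (l := 2 * x) (h := 2 * x + 1) (w := x)
    (y := x) (e₁ := 0) (e₂ := 0) (by omega) hN (by rw [hn]; nlinarith) ?_
    (AddSubgroup.eq_top_of_prod (mk_zero_mem (mem_closure_triple 1 0 0 ?_))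
      (zero_mk_mem (mem_closure_triple (-1) 1 0 ?_))) ?_ (by omega)
    (by omega) (by omega) (by omega) ?_ ?_ (by omega) (by omega)
  · simp only [Nat.card_prod, Nat.card_zmod, hN]
  · simp
  · ext
    · simp; decide
    · simp
  · ext
    · simp; decide
    · simp
  · ext
    · simp [h2]
    · simp; linear_combination h0
  · ext
    · simp [h2]
    · simp; linear_combination -2 * h0

/-! ### Diameter `3 * x + 1` -/

/-- Both sides are `2x + 1`, with area `(2x + 1)² - x² = n`. Evenness of `x` makes `x • c` vanish.
-/
theorem isMixedAbelianCayley_add_one_of_even (hx : 2 ≤ x) (he : Even x) {n N : ℕ}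
    (hn : n = 3 * x ^ 2 + 4 * x + 1) (hN : N = 2 * n) :
    IsMixedAbelianCayley
      ({(n : ZMod N), ((n + 1 : ℕ) : ZMod N), ((6 * x ^ 2 + 5 * x : ℕ) : ZMod N)} : Set (ZMod N))
      1 0 2 (3 * x + 1) N := by
  have : NeZero N := ⟨by rw [hN, hn]; positivity⟩
  have hn' : (n : ZMod N) = 3 * x ^ 2 + 4 * x + 1 := by exact_mod_cast congrArg Nat.cast hn
  have h0 : (2 * n : ZMod N) = 0 := by exact_mod_cast ZMod.natCast_eq_zero_of_eq hN
  obtain ⟨m, hm⟩ := he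
  have hm' : (x : ZMod N) = m + m := by exact_mod_cast congrArg Nat.cast hm
  refine isMixedAbelianCayley_of_relations (n := n) (l := 2 * x + 1) (h := 2 * x + 1) (w := x)
    (y := x) (e₁ := 0) (e₂ := 0) (by omega) hN (by rw [hn]; nlinarith) (Nat.card_zmod N)
    (closure_eq_top_of_one_mem (mem_closure_triple (-1) 1 0 ?_)) ?_ (by omega)
    (by omega) (by omega) (by omega) ?_ ?_ (by omega) (by omega)
  · simp
  · linear_combination h0
  · simp; linear_combination h0 + (2 * x - 1 : ZMod N) * hn'
  · simp; linear_combination (2 * x - m : ZMod N) * h0 - (n : ZMod N) * hm' - (4 * x : ZMod N) * hn'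

theorem isMixedAbelianCayley_add_one_of_even' (hx : 2 ≤ x) (he : Even x) {n N : ℕ}
    (hn : n = 3 * x ^ 2 + 4 * x + 1) (hN : N = 2 * n) :
    IsMixedAbelianCayley
      ({(n : ZMod N), (((n : ℕ) - 3 * x - 2 : ℤ) : ZMod N), ((n + 1 : ℕ) : ZMod N)} :
        Set (ZMod N))
      1 0 2 (3 * x + 1) N := by
  have : NeZero N := ⟨by rw [hN, hn]; positivity⟩
  have hn' : (n : ZMod N) = 3 * x ^ 2 + 4 * x + 1 := by exact_mod_cast congrArg Nat.cast hn
  have h0 : (2 * n : ZMod N) = 0 := by exact_mod_cast ZMod.natCast_eq_zero_of_eq hN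
  obtain ⟨m, hm⟩ := he
  have hm' : (x : ZMod N) = m + m := by exact_mod_cast congrArg Nat.cast hm
  refine isMixedAbelianCayley_of_relations (n := n) (l := 2 * x + 1) (h := 2 * x + 1) (w := x)
    (y := x) (e₁ := 1) (e₂ := 0) (by omega) hN (by rw [hn]; nlinarith) (Nat.card_zmod N)
    (closure_eq_top_of_one_mem (mem_closure_triple (-1) 0 1 ?_)) ?_ (by omega)
    (by omega) (by omega) (by omega) ?_ ?_ (by omega) (by omega)
  · simp
  · linear_combination h0
  · simp; linear_combination (m - 1 : ZMod N) * h0 + (n : ZMod N) * hm' + 2 * hn'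
  · simp; linear_combination (m + 1 : ZMod N) * h0 + (n : ZMod N) * hm' - hn'

theorem isMixedAbelianCayley_add_one_of_odd (hx : 2 ≤ x) (ho : Odd x) {n N : ℕ}
    (hn : n = 3 * x ^ 2 + 4 * x + 1) (hN : N = 2 * n) :
    IsMixedAbelianCayley
      ({(1, 0), (1, 1), (((-(3 * x) - 2 : ℤ) : ZMod 2), ((-(3 * x) - 2 : ℤ) : ZMod n))} :
        Set (ZMod 2 × ZMod n))
      1 0 2 (3 * x + 1) N := by
  have : NeZero n := ⟨by rw [hn]; positivity⟩
  have h2 : (x : ZMod 2) = 1 := (ZMod.natCast_eq_one_iff_odd).2 ho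
  have h0 : (3 * x ^ 2 + 4 * x + 1 : ZMod n) = 0 := by exact_mod_cast ZMod.natCast_eq_zero_of_eq hn
  refine isMixedAbelianCayley_of_relations (n := n) (l := 2 * x + 1) (h := 2 * x + 1) (w := x)
    (y := x) (e₁ := 0) (e₂ := 0) (by omega) hN (by rw [hn]; nlinarith) ?_
    (AddSubgroup.eq_top_of_prod (mk_zero_mem (mem_closure_triple 1 0 0 ?_))
      (zero_mk_mem (mem_closure_triple (-1) 1 0 ?_))) ?_ (by omega)
    (by omega) (by omega) (by omega) ?_ ?_ (by omega) (by omega)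
  · simp only [Nat.card_prod, Nat.card_zmod, hN]
  · simp
  · ext
    · simp; decide
    · simp
  · ext
    · simp; decide
    · simp
  · ext
    · simp [h2]; decide
    · simp; linear_combination h0
  · ext
    · simp [h2]; decide
    · simp; linear_combination -2 * h0

theorem isMixedAbelianCayley_add_one_of_odd' (hx : 2 ≤ x) (ho : Odd x) {n N : ℕ}
    (hn : n = 3 * x ^ 2 + 4 * x + 1) (hN : N = 2 * n) :
    IsMixedAbelianCayley
      ({(n : ZMod N), (((n : ℕ) - 3 * x - 2 : ℤ) : ZMod N), 1} : Set (ZMod N))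
      1 0 2 (3 * x + 1) N := by
  have : NeZero N := ⟨by rw [hN, hn]; positivity⟩
  have hn' : (n : ZMod N) = 3 * x ^ 2 + 4 * x + 1 := by exact_mod_cast congrArg Nat.cast hn
  have h0 : (2 * n : ZMod N) = 0 := by exact_mod_cast ZMod.natCast_eq_zero_of_eq hN
  obtain ⟨m, hm⟩ := ho
  have hm' : (x : ZMod N) = 2 * m + 1 := by exact_mod_cast congrArg Nat.cast hm
  refine isMixedAbelianCayley_of_relations (n := n) (l := 2 * x + 1) (h := 2 * x + 1) (w := x)
    (y := x) (e₁ := 1) (e₂ := 0) (by omega) hN (by rw [hn]; nlinarith) (Nat.card_zmod N)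
    (closure_eq_top_of_one_mem (mem_closure_triple 0 0 1 ?_)) ?_ (by omega)
    (by omega) (by omega) (by omega) ?_ ?_ (by omega) (by omega)
  · simp
  · linear_combination h0
  · simp; linear_combination (x - 1 : ZMod N) * h0 + 2 * hn'
  · simp; linear_combination -(m : ZMod N) * h0 - (n : ZMod N) * hm' - hn'

end Families

theorem mainTheorem1 :
    -- diameters 2, 3, 4
    (IsMaxMixedAbelianCayleyOrder 1 0 2 2 8 ∧
      IsMixedAbelianCayley ({1, 3, 4} : Set (ZMod 8)) 1 0 2 2 8) ∧
    (IsMaxMixedAbelianCayleyOrder 1 0 2 3 12 ∧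
      IsMixedAbelianCayley ({1, 4, 6} : Set (ZMod 12)) 1 0 2 3 12) ∧
    (IsMaxMixedAbelianCayleyOrder 1 0 2 4 18 ∧
      IsMixedAbelianCayley ({1, 4, 9} : Set (ZMod 18)) 1 0 2 4 18) ∧
    -- diameter 3x - 1
    (∀ x : ℕ, 2 ≤ x →
      IsMaxMixedAbelianCayleyOrder 1 0 2 (3 * x - 1) (6 * x ^ 2) ∧
      (Even x → IsMixedAbelianCayley
        ({(1, 0, 0), (1, 1, 1), (1, 3, 2)} : Set (ZMod 2 × ZMod x × ZMod (3 * x)))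
        1 0 2 (3 * x - 1) (6 * x ^ 2)) ∧
      (Odd x → IsMixedAbelianCayley
        ({(0, ((3 * x : ℤ) : ZMod (6 * x))), (1, -2),
          (((3 - x : ℤ) : ZMod x), ((3 * x - 7 : ℤ) : ZMod (6 * x)))} :
          Set (ZMod x × ZMod (6 * x)))
        1 0 2 (3 * x - 1) (6 * x ^ 2)) ∧
      IsMixedAbelianCayley
        ({(0, ((3 * x : ℤ) : ZMod (6 * x))), (3, 2), (1, 1)} : Set (ZMod x × ZMod (6 * x)))
        1 0 2 (3 * x - 1) (6 * x ^ 2)) ∧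
    -- diameter 3x, where N = 6x² + 4x and N / 2 = 3x² + 2x
    (∀ x N : ℕ, 2 ≤ x → N = 6 * x ^ 2 + 4 * x →
      IsMaxMixedAbelianCayleyOrder 1 0 2 (3 * x) N ∧
      (Even x → IsMixedAbelianCayley
        ({(1, 0), (1, 1), (((-(3 * x) : ℤ) : ZMod 2), ((-(3 * x) : ℤ) : ZMod (N / 2)))} :
          Set (ZMod 2 × ZMod (N / 2)))
        1 0 2 (3 * x) N) ∧
      (Odd x → IsMixedAbelianCayley
        ({((N / 2 : ℕ) : ZMod N), ((N / 2 + 1 : ℕ) : ZMod N), ((3 * x ^ 2 - x : ℤ) : ZMod N)} :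
          Set (ZMod N))
        1 0 2 (3 * x) N) ∧
      IsMixedAbelianCayley
        ({((N / 2 : ℕ) : ZMod N), ((2 * x + 1 : ℕ) : ZMod N), (x : ZMod N)} : Set (ZMod N))
        1 0 2 (3 * x) N) ∧
    -- diameter 3x + 1, where N = 6x² + 8x + 2 and N / 2 = 3x² + 4x + 1
    (∀ x N : ℕ, 2 ≤ x → N = 6 * x ^ 2 + 8 * x + 2 →
      IsMaxMixedAbelianCayleyOrder 1 0 2 (3 * x + 1) N ∧
      (Even x →
        IsMixedAbelianCayley
          ({((N / 2 : ℕ) : ZMod N), ((N / 2 + 1 : ℕ) : ZMod N),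
            ((6 * x ^ 2 + 5 * x : ℕ) : ZMod N)} : Set (ZMod N))
          1 0 2 (3 * x + 1) N ∧
        IsMixedAbelianCayley
          ({((N / 2 : ℕ) : ZMod N), (((N / 2 : ℕ) - 3 * x - 2 : ℤ) : ZMod N),
            ((N / 2 + 1 : ℕ) : ZMod N)} : Set (ZMod N))
          1 0 2 (3 * x + 1) N) ∧
      (Odd x →
        IsMixedAbelianCayley
          ({(1, 0), (1, 1),
            (((-(3 * x) - 2 : ℤ) : ZMod 2), ((-(3 * x) - 2 : ℤ) : ZMod (N / 2)))} :
            Set (ZMod 2 × ZMod (N / 2)))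
          1 0 2 (3 * x + 1) N ∧
        IsMixedAbelianCayley
          ({((N / 2 : ℕ) : ZMod N), (((N / 2 : ℕ) - 3 * x - 2 : ℤ) : ZMod N), 1} : Set (ZMod N))
          1 0 2 (3 * x + 1) N)) := by
  have hmax {k n m : ℕ} (hm : 3 * m ≤ (k + 1) ^ 2 ∨ 4 * m ≤ (k + 2) ^ 2)
      (h₁ : (k + 1) ^ 2 < 3 * (n + 1)) (h₂ : (k + 2) ^ 2 < 4 * (n + 1)) : m ≤ n := by omega
  refine ⟨⟨?_, isMixedAbelianCayley_eight⟩, ⟨?_, isMixedAbelianCayley_twelve⟩,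
    ⟨?_, isMixedAbelianCayley_eighteen⟩, ?_, ?_, ?_⟩
  -- For `k = 2, 3, 4` the bound `(k + 2)² / 4` allows `4, 6, 9`, while `(k + 1)² / 3` allows only
  -- `3, 5, 8`.
  · exact isMaxMixedAbelianCayleyOrder_of_witness (n := 4) (by norm_num) rfl
      isMixedAbelianCayley_eight fun m hm => hmax hm (by norm_num) (by norm_num)
  · exact isMaxMixedAbelianCayleyOrder_of_witness (n := 6) (by norm_num) rfl
      isMixedAbelianCayley_twelve fun m hm => hmax hm (by norm_num) (by norm_num)
  · exact isMaxMixedAbelianCayleyOrder_of_witness (n := 9) (by norm_num) rfl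
      isMixedAbelianCayley_eighteen fun m hm => hmax hm (by norm_num) (by norm_num)
  · intro x hx
    exact ⟨isMaxMixedAbelianCayleyOrder_of_le (by omega) (by ring) (sq_bound_sub_one hx)
        (isMixedAbelianCayley_sub_one hx), isMixedAbelianCayley_sub_one_of_even hx,
      isMixedAbelianCayley_sub_one_of_odd hx, isMixedAbelianCayley_sub_one hx⟩
  · intro x N hx hN
    obtain ⟨n, hn⟩ : ∃ n, n = 3 * x ^ 2 + 2 * x := ⟨_, rfl⟩
    have hN' : N = 2 * n := by omega
    rw [show N / 2 = n by omega]
    exact ⟨isMaxMixedAbelianCayleyOrder_of_le (by omega) hN' (by rw [hn]; nlinarith)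
        (isMixedAbelianCayley_three_mul hx hn hN'),
      fun he => isMixedAbelianCayley_three_mul_of_even hx he hn hN',
      fun ho => isMixedAbelianCayley_three_mul_of_odd hx ho hn hN',
      isMixedAbelianCayley_three_mul hx hn hN'⟩
  · intro x N hx hN
    obtain ⟨n, hn⟩ : ∃ n, n = 3 * x ^ 2 + 4 * x + 1 := ⟨_, rfl⟩
    have hN' : N = 2 * n := by omega
    rw [show N / 2 = n by omega]
    refine ⟨?_, fun he => ⟨isMixedAbelianCayley_add_one_of_even hx he hn hN',
        isMixedAbelianCayley_add_one_of_even' hx he hn hN'⟩,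
      fun ho => ⟨isMixedAbelianCayley_add_one_of_odd hx ho hn hN',
        isMixedAbelianCayley_add_one_of_odd' hx ho hn hN'⟩⟩
    have hb : (3 * x + 1 + 1) ^ 2 ≤ 3 * n + 1 := by rw [hn]; nlinarith
    -- Each family for this diameter covers one parity only, so maximality needs a witness from
    -- each.
    rcases Nat.even_or_odd x with he | ho
    · exact isMaxMixedAbelianCayleyOrder_of_le (by omega) hN' hb
        (isMixedAbelianCayley_add_one_of_even hx he hn hN')
    · exact isMaxMixedAbelianCayleyOrder_of_le (by omega) hN' hb
        (isMixedAbelianCayley_add_one_of_odd' hx ho hn hN')
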